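/- **Setting.** Let $K,B,T,d$ be non-negative integers and let $\mathcal{A}=\{a\in\{0,1\}^K:\|a\|_1=B\}$. In the combinatorial semi-bandit problem with action set $\mathcal{A}$, horizon $T$ and constant delay $d$, an oblivious adversary fixes, before the first round and independently of the learner's randomization, a (possibly random) loss sequence $\ell_1,\dots,\ell_T\in[-1,1]^K$. In each round $t=1,\dots,T$ the learner draws an action $a_t\in\mathcal{A}$ and suffers the loss $a_t^\top\ell_t$; the distribution from which $a_t$ is drawn may depend on the learner's earlier actions $a_1,\dots,a_{t-1}$ and on the delayed feedback $a_\tau\odot\ell_\tau$ (entrywise product) of the rounds $\tau$ with $\tau+d<t$, and on nothing else about the losses. An algorithm is any such rule, and it may be designed with knowledge of $K,B,T,d$. Let $a^\star\in\operatorname{argmin}_{a\in\mathcal{A}}\sum_{t=1}^T a^\top\ell_t$ be a best action in hindsight. **Theorem.** There is a universal constant $c>0$ such that for all $K,B,T,d$ with $B\le K/2$, $K\le BT$ and $d\le T$ there is a probability distribution of a random loss sequence $(\ell_1,\dots,\ell_T)\in([-1,1]^K)^T$, depending only on $K,B,T,d$, for which every algorithm satisfies $$\mathbb{E}\left[\sum_{t=1}^T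 (a_t-a^\star)^\top\ell_t\right]\ \ge\ c\,\max\left\{\sqrt{BKT},\ B\sqrt{dT}\right\},$$ where the expectation is over the loss sequence and the algorithm's randomization. -/

import Mathlib

/-! Delayed combinatorial semi-bandits with an oblivious adversary and a constant delay `d`.

Rounds are indexed by `Fin T`, coordinates by `Fin K`.  A vector of `{0,1}^K` is a function
`Fin K → Bool`, and an action set is a finite set of such vectors. -/

namespace DelayedSemiBandit

/-- The loss `aᵀ l` of the action `a ∈ {0,1}^K` under the loss vector `l ∈ ℝ^K`. -/
noncomputable def loss {K : ℕ} (a : Fin K → Bool) (l : Fin K → ℝ) : ℝ :=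
  ∑ i, if a i then l i else 0

/-- The semi-bandit feedback `a ⊙ l` (entrywise product). -/
noncomputable def feedback {K : ℕ} (a : Fin K → Bool) (l : Fin K → ℝ) : Fin K → ℝ :=
  fun i => if a i then l i else 0

/-- The action set of all `B`-sets: the vectors of `{0,1}^K` with exactly `B` ones. -/
def bSets (K B : ℕ) : Finset (Fin K → Bool) :=
  Finset.univ.filter fun a => (Finset.univ.filter fun i => a i = true).card = B

/-- A randomized algorithm for the action set `A`, the horizon `T` and the constant delay `d`.
In round `t` it draws its action from a distribution over `A` that may depend on all its own
earlier actions and on the feedback of exactly those rounds `τ` with `τ + d < t` (the feedback of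
round `τ` arrives at the end of round `τ + d`). -/
abbrev Algorithm {K : ℕ} (A : Finset (Fin K → Bool)) (T d : ℕ) : Type :=
  (t : Fin T) → ({τ : Fin T // τ < t} → A) →
    ({τ : Fin T // (τ : ℕ) + d < (t : ℕ)} → Fin K → ℝ) → PMF A

/-- The probability that the algorithm `π` plays the action sequence `a` when the loss sequence
is `l`: the product over the rounds of the conditional probability of `a t` given the past. -/
noncomputable def playProb {K T d : ℕ} {A : Finset (Fin K → Bool)} (π : Algorithm A T d)
    (l : Fin T → Fin K → ℝ) (a : Fin T → A) : ℝ :=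
  ∏ t, (π t (fun τ => a τ.1) (fun τ => feedback (a τ.1).1 (l τ.1)) (a t)).toReal

/-- The regret of the action sequence `a` against the best fixed action in hindsight:
`∑ₜ aₜᵀ lₜ - min_{b ∈ A} ∑ₜ bᵀ lₜ`. -/
noncomputable def regret {K T : ℕ} {A : Finset (Fin K → Bool)}
    (l : Fin T → Fin K → ℝ) (a : Fin T → A) : ℝ :=
  (∑ t, loss (a t).1 (l t)) - ⨅ b : A, ∑ t, loss b.1 (l t)

/-- The expected regret of the algorithm `π` on the loss sequence `l`; the expectation is over the
algorithm's randomization. -/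
noncomputable def expectedRegret {K T d : ℕ} {A : Finset (Fin K → Bool)} (π : Algorithm A T d)
    (l : Fin T → Fin K → ℝ) : ℝ :=
  ∑ a : Fin T → A, playProb π l a * regret l a

end DelayedSemiBandit

namespace DelayedSemiBandit

open Finset Function
open scoped BigOperators

/-! ### Marginalizing a sequential product of conditional probabilities -/

section Sequential

variable {T : ℕ} {A : Type*} [Fintype A]

/-! Two random loss sequences are built, one for each term of the maximum; the better one is used.

Delay: on each of the first `B` coordinates the loss is a fair sign, constant on blocks of length
`max 1 d`. The learner never sees a sign of the current block in time, so its mean loss is zero.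
Hindsight takes those of the `B` coordinates with negative total and fills up with zero-loss
coordinates, gaining `E|S|/2` per coordinate, of order `√(dT)`; the fourth-moment bound
`le_expect_abs_walk` makes this quantitative. This is `exists_pmf_block_bound`.

Limited feedback: all losses are independent signs, fair except for mean `-ε` on a random `B`-set.
Removing the bias of one good coordinate `i` changes the law of the play only through rounds that
play `i`, so the information about `i` is at most `ε²` times its pulls (`pulls_insert_le`). Once
neutral, `i` looks like every coordinate outside the set, so on average it gets at most `BT/(K-B)`
pulls (`mul_sum_perm_le`). With `ε` of order `√(K/(BT))` a good coordinate is missed in a constant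
fraction of rounds, which costs order `εBT = √(BKT)`. This is `exists_pmf_tilt_bound`; it needs `B`
small against `K`, and otherwise the block bound already dominates. -/

theorem sum_sum_update {ι : Type*} [Fintype ι] [DecidableEq ι] (G : (ι → A) → ℝ) (n : ι) :
    ∑ a : ι → A, ∑ b : A, G (update a n b) = Fintype.card A * ∑ a, G a := by
  have hinv : Involutive (fun p : (ι → A) × A => (update p.1 n p.2, p.1 n)) := by
    rintro ⟨a, b⟩
    simp
  have h := Equiv.sum_comp hinv.toPerm (fun p : (ι → A) × A => G p.1)
  simp only [Involutive.coe_toPerm, Fintype.sum_prod_type] at h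
  rw [h]
  simp [mul_sum]

/-- Summing out the rounds from `n` on in a product of conditional probabilities. -/
theorem card_pow_mul_sum_prod (q : Fin T → (Fin T → A) → ℝ)
    (hdep : ∀ s t a b, t < s → q t (update a s b) = q t a)
    (hsum : ∀ t a, ∑ b, q t (update a t b) = 1) (g : (Fin T → A) → ℝ) (k : ℕ) :
    ∀ n, n + k = T → (∀ (s : Fin T) a b, n ≤ (s : ℕ) → g (update a s b) = g a) →
      (Fintype.card A : ℝ) ^ k * ∑ a, (∏ t, q t a) * g a =
        ∑ a, (∏ t ∈ univ.filter fun t : Fin T => (t : ℕ) < n, q t a) * g a := by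
  induction k with
  | zero =>
    intro n hn _
    have : (univ.filter fun t : Fin T => (t : ℕ) < n) = univ := by
      ext t; simp; omega
    simp [this]
  | succ k ih =>
    intro n hn hg
    have hnT : n < T := by omega
    -- Sums always run over full action sequences, so each round summed out costs a factor `card A`:
    -- resample coordinate `n`, on which only the factor of round `n` depends.
    rw [pow_succ', mul_assoc, ih (n + 1) (by omega) (fun s a b hs => hg s a b (by omega)),
      ← sum_sum_update _ (⟨n, hnT⟩ : Fin T)]
    refine sum_congr rfl fun a _ => ?_
    have hins : (univ.filter fun t : Fin T => (t : ℕ) < n + 1) =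
        insert ⟨n, hnT⟩ (univ.filter fun t : Fin T => (t : ℕ) < n) := by
      ext t; simp [Fin.ext_iff]; omega
    have hterm : ∀ b, (∏ t ∈ univ.filter fun t : Fin T => (t : ℕ) < n + 1, q t (update a ⟨n, hnT⟩ b)) *
        g (update a ⟨n, hnT⟩ b) =
        (∏ t ∈ univ.filter fun t : Fin T => (t : ℕ) < n, q t a) * g a * q ⟨n, hnT⟩ (update a ⟨n, hnT⟩ b) := by
      intro b
      rw [hins, prod_insert (by simp), hg _ _ _ (le_refl n)]
      have : ∏ t ∈ univ.filter fun t : Fin T => (t : ℕ) < n, q t (update a ⟨n, hnT⟩ b) = ∏ t ∈ univ.filter fun t : Fin T => (t : ℕ) < n, q t a :=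
        prod_congr rfl fun t ht => hdep _ _ _ _ (by simpa [Fin.lt_def] using ht)
      rw [this]; ring
    rw [sum_congr rfl fun b _ => hterm b, ← mul_sum, hsum, mul_one]

end Sequential

/-! ### Play probabilities and their dependence on the losses -/

section Algorithm

variable {K T d : ℕ} {A : Finset (Fin K → Bool)}

/-- The conditional probability of the action of round `t` in the action sequence `a`. -/
noncomputable def stepProb (π : Algorithm A T d) (l : Fin T → Fin K → ℝ) (t : Fin T)
    (a : Fin T → A) : ℝ :=
  (π t (fun τ => a τ.1) (fun τ => feedback (a τ.1).1 (l τ.1)) (a t)).toReal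

theorem stepProb_update_of_lt (π : Algorithm A T d) (l : Fin T → Fin K → ℝ) (s t : Fin T)
    (a : Fin T → A) (b : A) (h : t < s) : stepProb π l t (update a s b) = stepProb π l t a := by
  have h1 : (fun τ : {τ : Fin T // τ < t} => update a s b τ.1) = fun τ => a τ.1 := by
    funext τ
    exact update_of_ne (τ.2.trans h).ne _ _
  have h2 : (fun τ : {τ : Fin T // (τ : ℕ) + d < (t : ℕ)} =>
      feedback (update a s b τ.1).1 (l τ.1)) = fun τ => feedback (a τ.1).1 (l τ.1) := by
    funext τ
    have : τ.1 ≠ s := by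
      have := τ.2
      rw [Fin.lt_def] at h
      intro he
      rw [he] at this
      omega
    rw [update_of_ne this]
  unfold stepProb
  rw [h1, h2, update_of_ne h.ne]

theorem sum_stepProb_update (π : Algorithm A T d) (l : Fin T → Fin K → ℝ) (t : Fin T)
    (a : Fin T → A) : ∑ b, stepProb π l t (update a t b) = 1 := by
  have h1 : ∀ b, (fun τ : {τ : Fin T // τ < t} => update a t b τ.1) = fun τ => a τ.1 := by
    intro b
    funext τ
    exact update_of_ne τ.2.ne _ _
  have h2 : ∀ b, (fun τ : {τ : Fin T // (τ : ℕ) + d < (t : ℕ)} =>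
      feedback (update a t b τ.1).1 (l τ.1)) = fun τ => feedback (a τ.1).1 (l τ.1) := by
    intro b
    funext τ
    have : τ.1 ≠ t := by
      have := τ.2
      intro he
      rw [he] at this
      omega
    rw [update_of_ne this]
  unfold stepProb
  simp only [h1, h2, update_self]
  rw [← ENNReal.toReal_sum (fun b _ => PMF.apply_ne_top _ _), ← tsum_fintype (L := .unconditional _), PMF.tsum_coe]
  rfl

theorem playProb_eq_prod (π : Algorithm A T d) (l : Fin T → Fin K → ℝ) (a : Fin T → A) :
    playProb π l a = ∏ t, stepProb π l t a := rfl

theorem playProb_nonneg (π : Algorithm A T d) (l : Fin T → Fin K → ℝ) (a : Fin T → A) :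
    0 ≤ playProb π l a := prod_nonneg fun _ _ => ENNReal.toReal_nonneg

theorem sum_playProb (hA : A.Nonempty) (π : Algorithm A T d) (l : Fin T → Fin K → ℝ) :
    ∑ a, playProb π l a = 1 := by
  have : Nonempty A := hA.to_subtype
  have hc : (Fintype.card A : ℝ) ^ T ≠ 0 :=
    pow_ne_zero _ (Nat.cast_ne_zero.2 Fintype.card_ne_zero)
  have h := card_pow_mul_sum_prod (stepProb π l) (stepProb_update_of_lt π l)
    (sum_stepProb_update π l) (fun _ => 1) T 0 (by simp) (fun _ _ _ _ => rfl)
  simp only [mul_one, not_lt_zero, filter_false, prod_empty, sum_const, card_univ,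
    Fintype.card_pi, prod_const, Fintype.card_fin, nsmul_eq_mul, Nat.cast_pow] at h
  simpa [playProb_eq_prod] using mul_left_cancel₀ hc (h.trans (mul_one _).symm)

/-- The probability that the action of round `t` contains the coordinate `i`. -/
noncomputable def actionProb (π : Algorithm A T d) (l : Fin T → Fin K → ℝ) (t : Fin T)
    (i : Fin K) : ℝ :=
  ∑ a, playProb π l a * if (a t).1 i then 1 else 0

/-- The action of round `t` only depends on the losses of the rounds `τ` with `τ + d < t`. -/
theorem actionProb_congr (hA : A.Nonempty) (π : Algorithm A T d) {l l' : Fin T → Fin K → ℝ}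
    (t : Fin T) (i : Fin K) (h : ∀ τ : Fin T, (τ : ℕ) + d < t → l τ = l' τ) :
    actionProb π l t i = actionProb π l' t i := by
  have : Nonempty A := hA.to_subtype
  have hc : (Fintype.card A : ℝ) ^ (T - (t + 1)) ≠ 0 :=
    pow_ne_zero _ (Nat.cast_ne_zero.2 Fintype.card_ne_zero)
  -- Rounds after `t` sum out; the remaining factors, up to and including `t`, see only feedback of
  -- rounds `τ` with `τ + d < t`.
  have key := fun l : Fin T → Fin K → ℝ => card_pow_mul_sum_prod (stepProb π l)
    (stepProb_update_of_lt π l) (sum_stepProb_update π l)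
    (fun a => if (a t).1 i then 1 else 0) (T - (t + 1)) (t + 1) (by omega) (by
      intro s a b hs
      have : t ≠ s := by rintro rfl; omega
      simp only [update_of_ne this])
  refine mul_left_cancel₀ hc ((key l).trans (Eq.trans ?_ (key l').symm))
  refine sum_congr rfl fun a _ => ?_
  congr 1
  refine prod_congr rfl fun s hs => ?_
  have hs' : (s : ℕ) ≤ t := by simpa [Nat.lt_succ_iff] using hs
  have h2 : (fun τ : {τ : Fin T // (τ : ℕ) + d < (s : ℕ)} => feedback (a τ.1).1 (l τ.1)) =
      fun τ => feedback (a τ.1).1 (l' τ.1) := by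
    funext τ
    rw [h τ.1 (τ.2.trans_le hs')]
  unfold stepProb
  rw [h2]

theorem actionProb_nonneg (π : Algorithm A T d) (l : Fin T → Fin K → ℝ) (t : Fin T)
    (i : Fin K) : 0 ≤ actionProb π l t i :=
  sum_nonneg fun a _ => mul_nonneg (playProb_nonneg π l a) (by split_ifs <;> norm_num)

theorem card_of_mem_bSets {B : ℕ} {a : Fin K → Bool} (ha : a ∈ bSets K B) :
    (univ.filter fun i => a i = true).card = B := by
  simpa [bSets] using ha

theorem bSets_nonempty {B : ℕ} (h : B ≤ K) : (bSets K B).Nonempty := by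
  obtain ⟨s, -, hs⟩ := exists_subset_card_eq (s := (univ : Finset (Fin K))) (n := B) (by simpa)
  exact ⟨fun i => decide (i ∈ s), by simpa [bSets] using hs⟩

theorem sum_actionProb {B : ℕ} (h : B ≤ K) (π : Algorithm (bSets K B) T d)
    (l : Fin T → Fin K → ℝ) (t : Fin T) : ∑ i, actionProb π l t i = B := by
  unfold actionProb
  rw [sum_comm]
  have : ∀ a : Fin T → bSets K B, ∑ i, playProb π l a * (if (a t).1 i then (1 : ℝ) else 0) =
      playProb π l a * B := by
    intro a
    have hc := card_of_mem_bSets (a t).2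
    rw [← mul_sum, sum_boole, hc]
  rw [sum_congr rfl fun a _ => this a, ← sum_mul, sum_playProb (bSets_nonempty h), one_mul]

/-- The regret against an arbitrary fixed action is a lower bound for the expected regret. -/
theorem le_expectedRegret (hA : A.Nonempty) (π : Algorithm A T d) (l : Fin T → Fin K → ℝ)
    (b : A) :
    ∑ t, ∑ i, actionProb π l t i * l t i - ∑ t, loss b.1 (l t) ≤ expectedRegret π l := by
  have h1 : ∑ t, ∑ i, actionProb π l t i * l t i =
      ∑ a, playProb π l a * ∑ t, loss (a t).1 (l t) := by
    simp only [actionProb, loss, sum_mul, mul_sum]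
    rw [sum_comm' (t' := univ) (s' := fun _ => univ) (by simp)]
    conv_rhs => rw [sum_comm]
    rw [sum_comm]
    refine sum_congr rfl fun t _ => ?_
    rw [sum_comm]
    refine sum_congr rfl fun a _ => sum_congr rfl fun i _ => ?_
    split_ifs <;> ring
  have h2 : ∑ t, loss b.1 (l t) = ∑ a, playProb π l a * ∑ t, loss b.1 (l t) := by
    rw [← sum_mul, sum_playProb hA, one_mul]
  rw [h1, h2, ← sum_sub_distrib]
  refine sum_le_sum fun a _ => ?_
  rw [← mul_sub]
  refine mul_le_mul_of_nonneg_left (sub_le_sub_left ?_ _) (playProb_nonneg π l a)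
  exact ciInf_le (Set.finite_range _).bddBelow b

end Algorithm

/-! ### Finitely supported loss distributions -/

section Mixture

/-- A finite mixture of point masses as a probability mass function. -/
theorem exists_pmf_of_weights {Ω E : Type*} [Fintype Ω] (w : Ω → ℝ) (hw : ∀ ω, 0 ≤ w ω)
    (hw1 : ∑ ω, w ω = 1) (L : Ω → E) :
    ∃ μ : PMF E, (∀ l ∈ μ.support, ∃ ω, L ω = l) ∧
      ∀ f : E → ℝ, ∑' l, (μ l).toReal * f l = ∑ ω, w ω * f (L ω) := by
  classical
  let p : PMF Ω := PMF.ofFintype (fun ω => ENNReal.ofReal (w ω)) (by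
    rw [← ENNReal.ofReal_sum_of_nonneg fun ω _ => hw ω, hw1, ENNReal.ofReal_one])
  refine ⟨p.map L, fun l hl => ?_, fun f => ?_⟩
  · obtain ⟨ω, -, h⟩ := (PMF.mem_support_map_iff L p l).1 hl
    exact ⟨ω, h⟩
  · have hp : ∀ l, (p.map L l).toReal = ∑ ω, if l = L ω then w ω else 0 := by
      intro l
      rw [PMF.map_apply, tsum_fintype, ENNReal.toReal_sum]
      · refine sum_congr rfl fun ω _ => ?_
        split_ifs
        · exact ENNReal.toReal_ofReal (hw ω)
        · rfl
      · intro ω _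
        split_ifs
        · exact PMF.apply_ne_top _ _
        · simp
    rw [tsum_eq_sum (s := univ.image L)]
    · simp only [hp, sum_mul]
      rw [sum_comm]
      refine sum_congr rfl fun ω _ => ?_
      rw [sum_eq_single (L ω)]
      · simp
      · intro l _ hl
        simp [hl]
      · simp
    · intro l hl
      rw [hp, sum_eq_zero, zero_mul]
      intro ω _
      rw [if_neg]
      rintro rfl
      exact hl (mem_image_of_mem L (mem_univ ω))

end Mixture

/-! ### Biased signs on the discrete cube -/

section Cube

variable {ι : Type*}

/-- The sign `±1` of a bit. -/
def rad (b : Bool) : ℝ := if b then 1 else -1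

theorem rad_not (b : Bool) : rad (!b) = -rad b := by cases b <;> simp [rad]

theorem rad_sq (b : Bool) : rad b ^ 2 = 1 := by cases b <;> simp [rad]

theorem rad_mem_Icc (b : Bool) : rad b ∈ Set.Icc (-1 : ℝ) 1 := by cases b <;> simp [rad]

/-- The density of the product measure under which the signs in `U` have mean `-ε`. -/
def tilt (ε : ℝ) (U : Finset ι) (ω : ι → Bool) : ℝ := ∏ u ∈ U, (1 - ε * rad (ω u))

theorem one_sub_mul_rad_pos {ε : ℝ} (h0 : 0 ≤ ε) (h1 : ε < 1) (b : Bool) :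
    0 < 1 - ε * rad b := by
  cases b <;> simp [rad] <;> linarith

theorem tilt_pos {ε : ℝ} (h0 : 0 ≤ ε) (h1 : ε < 1) (U : Finset ι) (ω : ι → Bool) :
    0 < tilt ε U ω := prod_pos fun _ _ => one_sub_mul_rad_pos h0 h1 _

variable [DecidableEq ι]

/-- Negate the bit `u`. -/
def flip (u : ι) (ω : ι → Bool) : ι → Bool := update ω u (!ω u)

theorem flip_apply_self (u : ι) (ω : ι → Bool) : flip u ω u = !ω u := by simp [flip]

theorem flip_apply_of_ne {u v : ι} (h : v ≠ u) (ω : ι → Bool) : flip u ω v = ω v :=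
  update_of_ne h _ _

theorem tilt_flip {ε : ℝ} {U : Finset ι} {u : ι} (hu : u ∉ U) (ω : ι → Bool) :
    tilt ε U (flip u ω) = tilt ε U ω :=
  prod_congr rfl fun v hv => by
    rw [flip_apply_of_ne]
    rintro rfl
    exact hu hv

theorem tilt_union {ε : ℝ} {U V : Finset ι} (h : Disjoint U V) (ω : ι → Bool) :
    tilt ε (U ∪ V) ω = tilt ε U ω * tilt ε V ω := prod_union h

variable [Fintype ι]

theorem expect_flip (u : ι) (f : (ι → Bool) → ℝ) : 𝔼 ω, f (flip u ω) = 𝔼 ω, f ω := by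
  have h : Involutive (flip u) := by
    intro ω
    simp [flip]
  exact Fintype.expect_equiv h.toPerm _ _ fun _ => rfl

/-- Flipping `u` preserves the uniform measure and negates the integrand. All independence arguments
below reduce to this symmetry. -/
theorem expect_mul_rad_eq_zero {u : ι} {F : (ι → Bool) → ℝ} (hF : ∀ ω, F (flip u ω) = F ω) :
    𝔼 ω, F ω * rad (ω u) = 0 := by
  have h := expect_flip u fun ω => F ω * rad (ω u)
  simp only [hF, flip_apply_self, rad_not, mul_neg, expect_neg_distrib] at h
  linarith

theorem expect_mul_tilt (ε : ℝ) (V : Finset ι) (F : (ι → Bool) → ℝ)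
    (hF : ∀ v ∈ V, ∀ ω, F (flip v ω) = F ω) : 𝔼 ω, F ω * tilt ε V ω = 𝔼 ω, F ω := by
  induction V using Finset.induction_on with
  | empty => simp [tilt]
  | insert v V hv ih =>
    have h1 : 𝔼 ω, (F ω * tilt ε V ω) * rad (ω v) = 0 :=
      expect_mul_rad_eq_zero fun ω => by rw [hF v (mem_insert_self v V), tilt_flip hv]
    have h2 : ∀ ω, F ω * tilt ε (insert v V) ω =
        F ω * tilt ε V ω - ε * ((F ω * tilt ε V ω) * rad (ω v)) := by
      intro ω
      rw [tilt, prod_insert hv, ← tilt]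
      ring
    simp only [h2, expect_sub_distrib, ← mul_expect, h1, mul_zero, sub_zero]
    exact ih fun u hu => hF u (mem_insert_of_mem hu)

theorem expect_tilt (ε : ℝ) (V : Finset ι) : 𝔼 ω, tilt ε V ω = 1 := by
  simpa using expect_mul_tilt ε V (fun _ => 1) fun _ _ _ => rfl

/-- Under the tilted measure the sign `u ∈ U` has mean `-ε`. -/
theorem expect_tilt_mul_rad {ε : ℝ} {U : Finset ι} {u : ι} (hu : u ∈ U) {F : (ι → Bool) → ℝ}
    (hF : ∀ ω, F (flip u ω) = F ω) :
    𝔼 ω, tilt ε U ω * (F ω * rad (ω u)) = -ε * 𝔼 ω, tilt ε U ω * F ω := by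
  -- For a sign `r`, `(1 - εr)r + ε(1 - εr) = (1 - ε²)r`, which explains the factor `1 - ε²`.
  have h1 : 𝔼 ω, ((1 - ε ^ 2) * (tilt ε (U.erase u) ω * F ω)) * rad (ω u) = 0 :=
    expect_mul_rad_eq_zero fun ω => by rw [hF, tilt_flip (notMem_erase u U)]
  rw [mul_expect, ← sub_eq_zero, ← expect_sub_distrib, ← h1]
  refine expect_congr rfl fun ω _ => ?_
  have h2 : tilt ε U ω = (1 - ε * rad (ω u)) * tilt ε (U.erase u) ω :=
    (mul_prod_erase U _ hu).symm
  rw [h2]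
  linear_combination (-ε * tilt ε (U.erase u) ω * F ω) * rad_sq (ω u)

theorem expect_tilt_mul_rad_of_notMem {ε : ℝ} {U : Finset ι} {u : ι} (hu : u ∉ U)
    {F : (ι → Bool) → ℝ} (hF : ∀ ω, F (flip u ω) = F ω) :
    𝔼 ω, tilt ε U ω * (F ω * rad (ω u)) = 0 := by
  rw [← expect_mul_rad_eq_zero (u := u) (F := fun ω => tilt ε U ω * F ω)
    fun ω => by rw [hF, tilt_flip hu]]
  simp only [mul_assoc]

end Cube

/-! ### Moments of weighted sums of signs -/

section Walk

variable {ι : Type*}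

/-- A weighted sum of signs. -/
def walk (c : ι → ℝ) (U : Finset ι) (ω : ι → Bool) : ℝ := ∑ u ∈ U, c u * rad (ω u)

variable [DecidableEq ι]

theorem walk_flip {c : ι → ℝ} {U : Finset ι} {u : ι} (hu : u ∉ U) (ω : ι → Bool) :
    walk c U (flip u ω) = walk c U ω :=
  sum_congr rfl fun v hv => by
    rw [flip_apply_of_ne]
    rintro rfl
    exact hu hv

variable [Fintype ι]

theorem expect_walk (c : ι → ℝ) (U : Finset ι) : 𝔼 ω, walk c U ω = 0 := by
  simp only [walk]
  rw [expect_sum_comm]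
  exact sum_eq_zero fun u _ => expect_mul_rad_eq_zero (F := fun _ => c u) fun _ => rfl

theorem expect_walk_sq (c : ι → ℝ) (U : Finset ι) :
    𝔼 ω, walk c U ω ^ 2 = ∑ u ∈ U, c u ^ 2 := by
  induction U using Finset.induction_on with
  | empty => simp [walk]
  | insert v U hv ih =>
    have h : ∀ ω, walk c (insert v U) ω ^ 2 =
        walk c U ω ^ 2 + (2 * c v * walk c U ω) * rad (ω v) + c v ^ 2 := by
      intro ω
      rw [walk, sum_insert hv, ← walk]
      linear_combination c v ^ 2 * rad_sq (ω v)
    simp only [h, expect_add_distrib, Fintype.expect_const]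
    rw [expect_mul_rad_eq_zero fun ω => by rw [walk_flip hv], ih, sum_insert hv]
    ring

theorem expect_walk_pow_four_le (c : ι → ℝ) (U : Finset ι) :
    𝔼 ω, walk c U ω ^ 4 ≤ 3 * (∑ u ∈ U, c u ^ 2) ^ 2 := by
  induction U using Finset.induction_on with
  | empty => simp [walk]
  | insert v U hv ih =>
    have h : ∀ ω, walk c (insert v U) ω ^ 4 =
        walk c U ω ^ 4 + 6 * c v ^ 2 * walk c U ω ^ 2 +
          (4 * c v * walk c U ω ^ 3 + 4 * c v ^ 3 * walk c U ω) * rad (ω v) + c v ^ 4 := by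
      intro ω
      rw [walk, sum_insert hv, ← walk]
      linear_combination (6 * walk c U ω ^ 2 * c v ^ 2 +
        4 * walk c U ω * c v ^ 3 * rad (ω v) + c v ^ 4 * (rad (ω v) ^ 2 + 1)) * rad_sq (ω v)
    simp only [h, expect_add_distrib, Fintype.expect_const]
    rw [expect_mul_rad_eq_zero fun ω => by rw [walk_flip hv], ← mul_expect, expect_walk_sq,
      sum_insert hv]
    nlinarith [sq_nonneg (c v ^ 2)]

/-- The second moment is `V` and the fourth at most `3V²`, so a lower bound for `|y|` by a
combination of `y²` and `y⁴` suffices. -/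
theorem le_expect_abs_walk (c : ι → ℝ) (U : Finset ι) :
    5 / 9 * √(∑ u ∈ U, c u ^ 2) ≤ 𝔼 ω, |walk c U ω| := by
  set V := ∑ u ∈ U, c u ^ 2 with hV
  have hV0 : 0 ≤ V := sum_nonneg fun u _ => sq_nonneg _
  rcases hV0.eq_or_lt with h0 | hpos
  · rw [← h0, Real.sqrt_zero, mul_zero]
    exact expect_nonneg fun _ _ => abs_nonneg _
  have hv : 0 < √V := Real.sqrt_pos.2 hpos
  have hvV : √V ^ 2 = V := Real.sq_sqrt hV0
  set v := √V
  have hpt : ∀ ω, v⁻¹ * walk c U ω ^ 2 - 4 / 27 * v⁻¹ ^ 3 * walk c U ω ^ 4 ≤ |walk c U ω| := by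
    intro ω
    have hs2 := sq_abs (walk c U ω)
    have hs4 : walk c U ω ^ 4 = |walk c U ω| ^ 4 := by
      rw [show 4 = 2 * 2 from rfl, pow_mul, pow_mul, hs2]
    have hy : 0 ≤ |walk c U ω| := abs_nonneg _
    rw [← hs2, hs4]
    set y := |walk c U ω|
    have hw : 0 < v⁻¹ := inv_pos.2 hv
    set w := v⁻¹
    -- With `z = wy`, `(z - 3/2)²(z + 3) = z³ - 27z/4 + 27/4`: this is `27/4` times the pointwise
    -- bound, with equality at `z = 3/2`.
    have : 0 ≤ y * ((w * y - 3 / 2) ^ 2 * (w * y + 3)) := by positivity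
    nlinarith
  have h := expect_le_expect (s := univ) fun ω _ => hpt ω
  rw [expect_sub_distrib, ← mul_expect, ← mul_expect, expect_walk_sq, ← hV] at h
  have h4 := expect_walk_pow_four_le c U
  rw [← hV] at h4
  have h5 : 4 / 27 * v⁻¹ ^ 3 * 𝔼 ω, walk c U ω ^ 4 ≤ 4 / 27 * v⁻¹ ^ 3 * (3 * V ^ 2) :=
    mul_le_mul_of_nonneg_left h4 (by positivity)
  have h6 : v⁻¹ * V = v := by rw [← hvV]; field_simp
  have h7 : 4 / 27 * v⁻¹ ^ 3 * (3 * V ^ 2) = 4 / 9 * v := by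
    rw [← hvV]; field_simp; norm_num
  linarith

end Walk

/-! ### The delay term: losses constant on blocks -/

section Blocks

variable {K T : ℕ}

/-- The index of the block of length `m` that contains the round `t`. -/
def block (m : ℕ) (t : Fin T) : Fin T := ⟨t / m, (Nat.div_le_self _ _).trans_lt t.2⟩

/-- Losses that are constant on the blocks, random on the first `B` coordinates and zero on the
others. -/
noncomputable def blockLoss (B m : ℕ) (ω : Fin T × Fin K → Bool) (t : Fin T) (i : Fin K) : ℝ :=
  if (i : ℕ) < B then rad (ω (block m t, i)) else 0

theorem blockLoss_mem_Icc (B m : ℕ) (ω : Fin T × Fin K → Bool) (t : Fin T) (i : Fin K) :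
    blockLoss B m ω t i ∈ Set.Icc (-1 : ℝ) 1 := by
  unfold blockLoss
  split_ifs
  · exact rad_mem_Icc _
  · simp

theorem block_ne {m d : ℕ} (hm : 0 < m) (hmd : m ≤ d + 1) {τ t : Fin T}
    (h : (τ : ℕ) + d < t) : block m τ ≠ block m t := by
  intro he
  have h1 : (τ : ℕ) / m = (t : ℕ) / m := congrArg Fin.val he
  have h2 : ((τ : ℕ) + m) / m ≤ (t : ℕ) / m := Nat.div_le_div_right (by omega)
  rw [Nat.add_div_right _ hm] at h2
  omega

/-- By `block_ne`, all feedback available in round `t` comes from other blocks, so the action is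
unaffected by flipping the sign that sets the current loss. -/
theorem expect_actionProb_mul_blockLoss {d : ℕ} {A : Finset (Fin K → Bool)} (hA : A.Nonempty)
    (π : Algorithm A T d) (B : ℕ) {m : ℕ} (hm : 0 < m) (hmd : m ≤ d + 1) (t : Fin T)
    (i : Fin K) :
    𝔼 ω, actionProb π (blockLoss B m ω) t i * blockLoss B m ω t i = 0 := by
  by_cases hi : (i : ℕ) < B
  · have h : ∀ ω, actionProb π (blockLoss B m ω) t i * blockLoss B m ω t i =
        actionProb π (blockLoss B m ω) t i * rad (ω (block m t, i)) := fun ω => by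
      rw [blockLoss, if_pos hi]
    simp only [h]
    refine expect_mul_rad_eq_zero fun ω => actionProb_congr hA π t i fun τ hτ => ?_
    funext j
    unfold blockLoss
    rw [flip_apply_of_ne]
    intro he
    exact block_ne hm hmd hτ (congrArg Prod.fst he)
  · simp [blockLoss, hi]

/-- The number of rounds in the block `u`. -/
def blockSize (T m : ℕ) (u : Fin T) : ℕ := (univ.filter fun t : Fin T => block m t = u).card

theorem sum_rad_block (m : ℕ) (ω : Fin T × Fin K → Bool) (i : Fin K) :
    ∑ t, rad (ω (block m t, i)) =
      walk (fun p => (blockSize T m p.1 : ℝ)) (univ ×ˢ {i}) ω := by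
  rw [walk, sum_product]
  simp only [sum_singleton]
  rw [← sum_fiberwise' univ (block m) fun u => rad (ω (u, i))]
  simp [blockSize]

/-- Cauchy–Schwarz over the nonempty blocks, of which there are at most `2T/m`; the last one may be
incomplete. -/
theorem le_sum_blockSize_sq {m : ℕ} (hm : 0 < m) (hmT : m ≤ T) :
    (m : ℝ) * T / 2 ≤ ∑ u, (blockSize T m u : ℝ) ^ 2 := by
  have hT : 0 < T := hm.trans_le hmT
  set I : Finset (Fin T) := univ.image (block m)
  have hI : I.card * m ≤ 2 * T := by
    have h1 : I.card ≤ (T - 1) / m + 1 := by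
      rw [← card_range ((T - 1) / m + 1)]
      refine card_le_card_of_injOn Fin.val (fun u hu => ?_) Fin.val_injective.injOn
      obtain ⟨t, -, rfl⟩ := mem_image.1 (mem_coe.1 hu)
      have : (t : ℕ) / m ≤ (T - 1) / m := Nat.div_le_div_right (by omega)
      simpa [block, Nat.lt_succ_iff] using this
    have h2 := Nat.div_mul_le_self (T - 1) m
    calc I.card * m ≤ ((T - 1) / m + 1) * m := Nat.mul_le_mul_right m h1
      _ = (T - 1) / m * m + m := by ring
      _ ≤ 2 * T := by omega
  have hsum : (T : ℝ) = ∑ u ∈ I, (blockSize T m u : ℝ) := by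
    have := card_eq_sum_card_image (block m) (univ : Finset (Fin T))
    rw [card_univ, Fintype.card_fin] at this
    exact_mod_cast this
  have hcs := sq_sum_le_card_mul_sum_sq (s := I) (f := fun u => (blockSize T m u : ℝ))
  rw [← hsum] at hcs
  have hle : ∑ u ∈ I, (blockSize T m u : ℝ) ^ 2 ≤ ∑ u, (blockSize T m u : ℝ) ^ 2 :=
    sum_le_sum_of_subset_of_nonneg (subset_univ _) fun _ _ _ => sq_nonneg _
  set V := ∑ u, (blockSize T m u : ℝ) ^ 2
  have hV : 0 ≤ V := sum_nonneg fun _ _ => sq_nonneg _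
  have hI' : (I.card : ℝ) * m ≤ 2 * T := by exact_mod_cast hI
  have hT' : (0 : ℝ) < T := by exact_mod_cast hT
  have h3 : (m : ℝ) * T * T ≤ 2 * V * T := by
    calc (m : ℝ) * T * T = m * T ^ 2 := by ring
      _ ≤ m * (I.card * V) := by
        refine mul_le_mul_of_nonneg_left (hcs.trans ?_) m.cast_nonneg
        exact mul_le_mul_of_nonneg_left hle (Nat.cast_nonneg _)
      _ = (I.card * m) * V := by ring
      _ ≤ 2 * T * V := mul_le_mul_of_nonneg_right hI' hV
      _ = 2 * V * T := by ring
  linarith [le_of_mul_le_mul_right h3 hT']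

/-- Take every random coordinate with negative total and complete with zero-loss coordinates. There
are `K - B ≥ B` of these, so no coordinate with nonnegative total is needed. -/
theorem exists_bSet_sum_loss_le {B : ℕ} (h : 2 * B ≤ K) (m : ℕ)
    (ω : Fin T × Fin K → Bool) : ∃ b ∈ bSets K B, ∑ t, loss b (blockLoss B m ω t) ≤
      ∑ i ∈ univ.filter fun i : Fin K => (i : ℕ) < B,
        (∑ t, rad (ω (block m t, i)) - |∑ t, rad (ω (block m t, i))|) / 2 := by
  set S : Fin K → ℝ := fun i => ∑ t, rad (ω (block m t, i))
  set N : Finset (Fin K) := univ.filter fun i => (i : ℕ) < B ∧ S i < 0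
  set R : Finset (Fin K) := univ.filter fun i => ¬ (i : ℕ) < B
  have hlow : (univ.filter fun i : Fin K => (i : ℕ) < B).card = B := by
    rw [Fin.card_filter_val_lt]; omega
  have hN : N.card ≤ B := by
    rw [← hlow]
    exact card_le_card fun i hi => by
      simp only [N, mem_filter, mem_univ, true_and] at hi ⊢
      exact hi.1
  have hR : B ≤ (N ∪ R).card := by
    have h1 := card_filter_add_card_filter_not (s := (univ : Finset (Fin K)))
      (fun i => (i : ℕ) < B)
    rw [hlow, card_univ, Fintype.card_fin] at h1
    have h2 : R.card ≤ (N ∪ R).card := card_le_card subset_union_right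
    simp only [R] at h2 ⊢
    omega
  obtain ⟨X, hNX, hXR, hX⟩ := exists_subsuperset_card_eq subset_union_left hN hR
  refine ⟨fun i => decide (i ∈ X), by simpa [bSets] using hX, ?_⟩
  have h1 : ∑ t, loss (fun i => decide (i ∈ X)) (blockLoss B m ω t) =
      ∑ i : Fin K, if (i : ℕ) < B then (if i ∈ X then S i else 0) else 0 := by
    simp only [loss, blockLoss, decide_eq_true_eq]
    rw [sum_comm]
    refine sum_congr rfl fun i _ => ?_
    split_ifs <;> simp [S]
  rw [h1, sum_filter]
  refine sum_le_sum fun i _ => ?_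
  split_ifs with hi hiX
  · have : i ∈ N := (mem_union.1 (hXR hiX)).resolve_right (by simp [R, hi])
    have hneg : S i < 0 := by simp only [N, mem_filter] at this; exact this.2.2
    change S i ≤ (S i - |S i|) / 2
    rw [abs_of_neg hneg]; linarith
  · have hpos : 0 ≤ S i := by
      by_contra hc
      exact hiX (hNX (by simp [N, hi, not_le.1 hc]))
    change 0 ≤ (S i - |S i|) / 2
    rw [abs_of_nonneg hpos]; linarith
  · exact le_rfl

/-- The lower bound from losses that are constant on blocks no longer than the delay. -/
theorem exists_pmf_block_bound {B d : ℕ} (h : 2 * B ≤ K) (hd : d ≤ T) :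
    ∃ μ : PMF (Fin T → Fin K → ℝ),
      (∀ l ∈ μ.support, ∀ t i, l t i ∈ Set.Icc (-1 : ℝ) 1) ∧
      ∀ π : Algorithm (bSets K B) T d,
        1 / 6 * (B * √((max 1 d : ℕ) * T)) ≤ ∑' l, (μ l).toReal * expectedRegret π l := by
  -- The `1` keeps blocks nonempty at `d = 0` and yields `B√T` there, which the final case split
  -- needs.
  set m := max 1 d with hmdef
  have hm : 0 < m := by omega
  have hmd : m ≤ d + 1 := by omega
  have hne := bSets_nonempty (K := K) (B := B) (by omega)
  obtain ⟨μ, hμ, hf⟩ := exists_pmf_of_weights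
    (fun _ : Fin T × Fin K → Bool => (Fintype.card (Fin T × Fin K → Bool) : ℝ)⁻¹)
    (fun _ => by positivity) (by simp) (blockLoss B m)
  refine ⟨μ, fun l hl t i => ?_, fun π => ?_⟩
  · obtain ⟨ω, rfl⟩ := hμ l hl
    exact blockLoss_mem_Icc B m ω t i
  rw [hf, ← mul_sum, inv_mul_eq_div, ← Fintype.expect_eq_sum_div_card]
  set S : Fin K → (Fin T × Fin K → Bool) → ℝ := fun i ω => ∑ t, rad (ω (block m t, i))
  have hreg : ∀ ω, ∑ t, ∑ i, actionProb π (blockLoss B m ω) t i * blockLoss B m ω t i -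
      ∑ i ∈ univ.filter fun i : Fin K => (i : ℕ) < B, (S i ω - |S i ω|) / 2 ≤
        expectedRegret π (blockLoss B m ω) := by
    intro ω
    obtain ⟨b, hb, hle⟩ := exists_bSet_sum_loss_le h m ω
    exact (sub_le_sub_left hle _).trans (le_expectedRegret hne π _ ⟨b, hb⟩)
  refine le_trans ?_ (expect_le_expect fun ω _ => hreg ω)
  rw [expect_sub_distrib, expect_sum_comm, expect_sum_comm]
  simp only [expect_sum_comm, expect_actionProb_mul_blockLoss hne π B hm hmd, sum_const_zero,
    zero_sub]
  rw [← sum_neg_distrib]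
  have hS : ∀ i, 1 / 6 * √(m * T) ≤ -𝔼 ω, (S i ω - |S i ω|) / 2 := by
    intro i
    have h0 : 𝔼 ω, S i ω = 0 := by simp only [S, sum_rad_block, expect_walk]
    have h1 := le_expect_abs_walk (fun p : Fin T × Fin K => (blockSize T m p.1 : ℝ))
      (univ ×ˢ {i})
    simp only [← sum_rad_block, sum_product, sum_singleton] at h1
    -- `(3/5)² ≤ 1/2`; then `1/2 · 5/9 · 3/5 = 1/6`. The case `T = 0` is separate because `m ≤ T`
    -- fails there.
    have h2 : 3 / 5 * √(m * T) ≤ √(∑ u, (blockSize T m u : ℝ) ^ 2) := by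
      rcases Nat.eq_zero_or_pos T with hT | hT
      · simp [hT]
      refine Real.le_sqrt_of_sq_le ?_
      rw [mul_pow, Real.sq_sqrt (by positivity)]
      have := le_sum_blockSize_sq (T := T) hm (by omega)
      have : (0 : ℝ) ≤ m * T := by positivity
      linarith
    rw [← expect_div, expect_sub_distrib, h0]
    change _ ≤ 𝔼 ω, |S i ω| at h1
    linarith
  calc 1 / 6 * (B * √(m * T)) = ∑ i ∈ univ.filter fun i : Fin K => (i : ℕ) < B, 1 / 6 * √(m * T) := by
        rw [sum_const, Fin.card_filter_val_lt, min_eq_right (by omega), nsmul_eq_mul]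
        ring
    _ ≤ _ := sum_le_sum fun i _ => hS i

end Blocks

/-! ### The feedback term: information gained from playing a coordinate -/

section Tilted

variable {K T d : ℕ} {A : Finset (Fin K → Bool)}

/-- The loss sequence given by independent signs. -/
noncomputable def signLoss (ω : Fin T × Fin K → Bool) (t : Fin T) (i : Fin K) : ℝ :=
  rad (ω (t, i))

theorem actionProb_signLoss_flip (hA : A.Nonempty) (π : Algorithm A T d) (t : Fin T)
    (i j : Fin K) (ω : Fin T × Fin K → Bool) :
    actionProb π (signLoss (flip (t, j) ω)) t i = actionProb π (signLoss ω) t i := by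
  refine actionProb_congr hA π t i fun τ hτ => ?_
  funext k
  unfold signLoss
  rw [flip_apply_of_ne]
  intro he
  have : τ = t := congrArg Prod.fst he
  subst this
  omega

/-- Here the semi-bandit restriction enters: a bit that is not played never reaches the learner. -/
theorem playProb_signLoss_flip (π : Algorithm A T d) (a : Fin T → A) {t : Fin T} {i : Fin K}
    (h : ¬ (a t).1 i = true) (ω : Fin T × Fin K → Bool) :
    playProb π (signLoss (flip (t, i) ω)) a = playProb π (signLoss ω) a := by
  have hfb : ∀ τ, feedback (a τ).1 (signLoss (flip (t, i) ω) τ) =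
      feedback (a τ).1 (signLoss ω τ) := by
    intro τ
    funext j
    unfold feedback signLoss
    split_ifs with hj
    · rw [flip_apply_of_ne]
      intro he
      obtain ⟨rfl, rfl⟩ := Prod.mk.inj he
      exact h hj
    · rfl
  unfold playProb
  simp only [hfb]

/-- The expected number of rounds in which the coordinate `i` is played, when the losses of the
coordinates in `S` have mean `-ε`. -/
noncomputable def pulls (ε : ℝ) (π : Algorithm A T d) (S : Finset (Fin K)) (i : Fin K) : ℝ :=
  ∑ t, 𝔼 ω, tilt ε (univ ×ˢ S) ω * actionProb π (signLoss ω) t i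

theorem pulls_nonneg {ε : ℝ} (h0 : 0 ≤ ε) (h1 : ε < 1) (π : Algorithm A T d)
    (S : Finset (Fin K)) (i : Fin K) : 0 ≤ pulls ε π S i :=
  sum_nonneg fun t _ => expect_nonneg fun ω _ =>
    mul_nonneg (tilt_pos h0 h1 _ ω).le (actionProb_nonneg π _ t i)

theorem sum_pulls {B : ℕ} (h : B ≤ K) (ε : ℝ) (π : Algorithm (bSets K B) T d)
    (S : Finset (Fin K)) : ∑ i, pulls ε π S i = B * T := by
  unfold pulls
  rw [sum_comm]
  simp only [← expect_sum_comm, ← mul_sum, sum_actionProb h, ← expect_mul, expect_tilt]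
  simp [mul_comm]

/-- Under the tilted measure the algorithm gains `ε` for each coordinate of `S` that it plays. -/
theorem le_expect_tilt_mul_expectedRegret {B : ℕ} (h : B ≤ K) {ε : ℝ} (h0 : 0 ≤ ε) (h1 : ε < 1)
    (π : Algorithm (bSets K B) T d) {S : Finset (Fin K)} (hS : S.card = B) :
    ε * ∑ i ∈ S, (T - pulls ε π S i) ≤
      𝔼 ω, tilt ε (univ ×ˢ S) ω * expectedRegret π (signLoss ω) := by
  have hne := bSets_nonempty h
  have hb : (fun i => decide (i ∈ S)) ∈ bSets K B := by simpa [bSets] using hS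
  refine le_trans (le_of_eq ?_) (expect_le_expect fun ω _ => mul_le_mul_of_nonneg_left
    (le_expectedRegret hne π (signLoss ω) ⟨_, hb⟩) (tilt_pos h0 h1 _ ω).le)
  have hlearn : ∀ (t : Fin T) (i : Fin K),
      𝔼 ω, tilt ε (univ ×ˢ S) ω * (actionProb π (signLoss ω) t i * signLoss ω t i) =
        if i ∈ S then -ε * 𝔼 ω, tilt ε (univ ×ˢ S) ω * actionProb π (signLoss ω) t i else 0 := by
    intro t i
    unfold signLoss
    split_ifs with hi
    · exact expect_tilt_mul_rad (by simp [hi]) (actionProb_signLoss_flip hne π t i i)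
    · exact expect_tilt_mul_rad_of_notMem (by simp [hi]) (actionProb_signLoss_flip hne π t i i)
  have hcomp : ∀ (t : Fin T), ∀ i ∈ S, 𝔼 ω, tilt ε (univ ×ˢ S) ω * signLoss ω t i = -ε := by
    intro t i hi
    have := expect_tilt_mul_rad (ε := ε) (U := univ ×ˢ S) (u := (t, i)) (by simp [hi])
      (F := fun _ => 1) fun _ => rfl
    simpa [expect_tilt, signLoss] using this
  have hloss : ∀ (ω : Fin T × Fin K → Bool) t, loss (fun i => decide (i ∈ S)) (signLoss ω t) =
      ∑ i ∈ S, signLoss ω t i := by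
    intro ω t
    simp [loss]
  have hcomp' : ∀ t : Fin T, ∑ i ∈ S, 𝔼 ω, tilt ε (univ ×ˢ S) ω * signLoss ω t i =
      ∑ i ∈ S, -ε := fun t => sum_congr rfl (hcomp t)
  simp only [hloss, mul_sub, mul_sum, expect_sub_distrib, expect_sum_comm, hlearn, hcomp']
  simp only [sum_ite_mem, univ_inter, pulls, sum_sub_distrib, sum_const, card_univ,
    Fintype.card_fin, nsmul_eq_mul, mul_sum]
  rw [sum_comm]
  simp only [neg_mul, sum_neg_distrib]
  ring

/-- The rounds in which `a` plays the coordinate `i`, as a set of bits. -/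
def played (a : Fin T → A) (i : Fin K) : Finset (Fin T × Fin K) :=
  (univ.filter fun t => (a t).1 i = true) ×ˢ {i}

/-- Change of measure: the density factors of the unplayed bits of `i` integrate to one, so the
likelihood ratio involves only the played ones. -/
theorem expect_tilt_insert_mul_playProb (ε : ℝ) (π : Algorithm A T d) {S : Finset (Fin K)}
    {i : Fin K} (hi : i ∉ S) (a : Fin T → A) :
    𝔼 ω, tilt ε (univ ×ˢ insert i S) ω * playProb π (signLoss ω) a =
      𝔼 ω, tilt ε (univ ×ˢ S) ω * (playProb π (signLoss ω) a * tilt ε (played a i) ω) := by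
  set V : Finset (Fin T × Fin K) := (univ.filter fun t => ¬ (a t).1 i = true) ×ˢ {i}
  have hV : ∀ v ∈ V, v.2 = i ∧ ¬ (a v.1).1 i = true := by
    rintro ⟨t, j⟩ hv
    simp only [V, mem_product, mem_filter, mem_univ, true_and, mem_singleton] at hv
    exact ⟨hv.2, hv.1⟩
  have hP : ∀ v ∈ played a i, v.2 = i ∧ (a v.1).1 i = true := by
    rintro ⟨t, j⟩ hv
    simp only [played, mem_product, mem_filter, mem_univ, true_and, mem_singleton] at hv
    exact ⟨hv.2, hv.1⟩
  have hSV : ∀ v : Fin T × Fin K, v.2 = i → v ∉ (univ : Finset (Fin T)) ×ˢ S := by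
    rintro ⟨t, j⟩ rfl
    simpa using hi
  have hdisj1 : Disjoint ((univ : Finset (Fin T)) ×ˢ S) (played a i) :=
    disjoint_right.2 fun v hv => hSV v (hP v hv).1
  have hVP : ∀ v ∈ V, v ∉ played a i := fun v hv hp => (hV v hv).2 (hP v hp).2
  have hdisj2 : Disjoint ((univ : Finset (Fin T)) ×ˢ S ∪ played a i) V :=
    disjoint_right.2 fun v hv hm => (mem_union.1 hm).elim (hSV v (hV v hv).1) (hVP v hv)
  have hU : (univ : Finset (Fin T)) ×ˢ insert i S = univ ×ˢ S ∪ played a i ∪ V := by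
    ext ⟨t, j⟩
    simp only [V, played, mem_product, mem_union, mem_filter, mem_univ, true_and,
      mem_singleton, mem_insert]
    tauto
  have h := expect_mul_tilt ε V
    (fun ω => tilt ε (univ ×ˢ S) ω * (playProb π (signLoss ω) a * tilt ε (played a i) ω)) (by
      rintro ⟨t, j⟩ hv ω
      obtain ⟨rfl, hv2⟩ := hV _ hv
      simp only
      rw [tilt_flip (hSV _ (hV _ hv).1), tilt_flip (hVP _ hv), playProb_signLoss_flip π a hv2])
  rw [← h]
  refine expect_congr rfl fun ω _ => ?_
  rw [hU, tilt_union hdisj2, tilt_union hdisj1]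
  ring

theorem pulls_eq_sum_playProb (ε : ℝ) (π : Algorithm A T d) (S : Finset (Fin K)) (i : Fin K) :
    pulls ε π S i = ∑ a : Fin T → A, (∑ t, if (a t).1 i then (1 : ℝ) else 0) *
      𝔼 ω, tilt ε (univ ×ˢ S) ω * playProb π (signLoss ω) a := by
  simp only [pulls, actionProb, mul_sum, sum_mul, expect_sum_comm]
  rw [sum_comm]
  refine sum_congr rfl fun a _ => sum_congr rfl fun t _ => ?_
  rw [mul_expect]
  exact expect_congr rfl fun ω _ => by ring

theorem sum_expect_tilt_mul_playProb (hA : A.Nonempty) (ε : ℝ) (π : Algorithm A T d)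
    (S : Finset (Fin K)) :
    ∑ a : Fin T → A, 𝔼 ω, tilt ε (univ ×ˢ S) ω * playProb π (signLoss ω) a = 1 := by
  simp only [← expect_sum_comm, ← mul_sum, sum_playProb hA, mul_one, expect_tilt]

theorem log_one_sub_mul_rad {ε : ℝ} (h0 : 0 ≤ ε) (h1 : ε < 1) (b : Bool) :
    Real.log (1 - ε * rad b) = Real.log (1 - ε ^ 2) / 2 +
      (Real.log (1 - ε) - Real.log (1 + ε)) / 2 * rad b := by
  have h : Real.log (1 - ε ^ 2) = Real.log (1 - ε) + Real.log (1 + ε) := by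
    rw [← Real.log_mul (by linarith) (by linarith)]
    ring_nf
  rw [h]
  cases b <;> simp [rad] <;> ring

theorem neg_sq_le_log {ε : ℝ} (h : ε ^ 2 ≤ 1 / 2) : -ε ^ 2 ≤ Real.log (1 - ε ^ 2) / 2 := by
  have hpos : 0 < 1 - ε ^ 2 := by linarith
  have h1 := Real.one_sub_inv_le_log_of_pos hpos
  have h2 : (1 - ε ^ 2)⁻¹ ≤ 1 + 2 * ε ^ 2 := by
    rw [inv_le_iff_one_le_mul₀ hpos]
    nlinarith [sq_nonneg ε]
  linarith

/-- Minus the left side is a relative entropy, computed by the chain rule. The action of round `t`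
does not depend on the fair bit `(t, i)`, so only the even part of `log (1 - εr)` survives. -/
theorem sum_expect_tilt_mul_log (hA : A.Nonempty) {ε : ℝ} (h0 : 0 ≤ ε) (h1 : ε < 1)
    (π : Algorithm A T d) {S : Finset (Fin K)} {i : Fin K} (hi : i ∉ S) :
    ∑ a : Fin T → A, 𝔼 ω, tilt ε (univ ×ˢ S) ω *
        (playProb π (signLoss ω) a * Real.log (tilt ε (played a i) ω)) =
      Real.log (1 - ε ^ 2) / 2 * pulls ε π S i := by
  have hlog : ∀ (a : Fin T → A) (ω : Fin T × Fin K → Bool),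
      Real.log (tilt ε (played a i) ω) = ∑ t, (if (a t).1 i then (1 : ℝ) else 0) *
        Real.log (1 - ε * rad (ω (t, i))) := by
    intro a ω
    rw [tilt, Real.log_prod fun u _ => (one_sub_mul_rad_pos h0 h1 _).ne', played, sum_product]
    simp [sum_filter]
  have hswap : ∑ a : Fin T → A, 𝔼 ω, tilt ε (univ ×ˢ S) ω *
        (playProb π (signLoss ω) a * Real.log (tilt ε (played a i) ω)) =
      ∑ t, 𝔼 ω, tilt ε (univ ×ˢ S) ω *
        (actionProb π (signLoss ω) t i * Real.log (1 - ε * rad (ω (t, i)))) := by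
    simp only [hlog, actionProb, mul_sum, sum_mul, expect_sum_comm]
    rw [sum_comm]
    exact sum_congr rfl fun t _ => sum_congr rfl fun a _ => expect_congr rfl fun ω _ => by ring
  rw [hswap, pulls, mul_sum]
  refine sum_congr rfl fun t _ => ?_
  have hz := expect_tilt_mul_rad_of_notMem (ε := ε) (U := univ ×ˢ S) (u := (t, i)) (by simp [hi])
    (F := fun ω => actionProb π (signLoss ω) t i) (actionProb_signLoss_flip hA π t i i)
  rw [mul_expect, ← sub_eq_zero, ← expect_sub_distrib]
  rw [← mul_zero ((Real.log (1 - ε) - Real.log (1 + ε)) / 2), ← hz, mul_expect]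
  refine expect_congr rfl fun ω _ => ?_
  rw [log_one_sub_mul_rad h0 h1]
  ring

/-- A pointwise substitute for Pinsker: `L - 1 = (√L - 1)(√L + 1)`, apply AM–GM, and use `(√L - 1)²
≤ L - 1 - log L` and `(√L + 1)² ≤ 2(1 + L)`. -/
theorem sub_one_le_log_bound {L : ℝ} (hL : 0 < L) :
    L - 1 ≤ 4 * (L - 1 - Real.log L) + (1 + L) / 8 := by
  have hr : 0 < √L := Real.sqrt_pos.2 hL
  have h1 := Real.log_le_sub_one_of_pos hr
  rw [Real.log_sqrt hL.le] at h1
  have h2 : √L ^ 2 = L := Real.sq_sqrt hL.le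
  nlinarith [sq_nonneg (4 * (√L - 1) - (√L + 1) / 2), sq_nonneg (√L - 1)]

/-- Making the coordinate `i` better only changes how often it is played if it is played often. -/
theorem pulls_insert_le (hA : A.Nonempty) {ε : ℝ} (h0 : 0 ≤ ε) (hε : ε ^ 2 ≤ 1 / 2)
    (π : Algorithm A T d) {S : Finset (Fin K)} {i : Fin K} (hi : i ∉ S) :
    pulls ε π (insert i S) i ≤
      pulls ε π S i + T * (4 * ε ^ 2 * pulls ε π S i + 1 / 4) := by
  have h1 : ε < 1 := by nlinarith
  set E : ((Fin T × Fin K → Bool) → (Fin T → A) → ℝ) → ℝ := fun f =>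
    ∑ a : Fin T → A, 𝔼 ω, tilt ε (univ ×ˢ S) ω * (playProb π (signLoss ω) a * f ω a) with hE
  set N : (Fin T → A) → ℝ := fun a => ∑ t, if (a t).1 i then (1 : ℝ) else 0
  have hN0 : ∀ a, 0 ≤ N a := fun a => sum_nonneg fun t _ => by split_ifs <;> norm_num
  have hNT : ∀ a, N a ≤ T := fun a => by
    calc N a ≤ ∑ t : Fin T, (1 : ℝ) := sum_le_sum fun t _ => by split_ifs <;> norm_num
      _ = T := by simp
  have hone : E (fun _ _ => 1) = 1 := by
    simp only [hE, mul_one]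
    exact sum_expect_tilt_mul_playProb hA ε π S
  have hL : E (fun ω a => tilt ε (played a i) ω) = 1 := by
    simp only [hE, ← expect_tilt_insert_mul_playProb ε π hi]
    exact sum_expect_tilt_mul_playProb hA ε π _
  have hlog : E (fun ω a => Real.log (tilt ε (played a i) ω)) =
      Real.log (1 - ε ^ 2) / 2 * pulls ε π S i := sum_expect_tilt_mul_log hA h0 h1 π hi
  have hN : E (fun _ a => N a) = pulls ε π S i := by
    rw [pulls_eq_sum_playProb]
    refine sum_congr rfl fun a _ => ?_
    rw [mul_expect]
    exact expect_congr rfl fun ω _ => by ring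
  have hNL : E (fun ω a => N a * tilt ε (played a i) ω) = pulls ε π (insert i S) i := by
    rw [pulls_eq_sum_playProb]
    refine sum_congr rfl fun a _ => ?_
    rw [expect_tilt_insert_mul_playProb ε π hi, mul_expect]
    exact expect_congr rfl fun ω _ => by ring
  -- Write `NL = N + N(L - 1)` and use `0 ≤ N ≤ T`. As `E 1 = E L = 1`, the last term contributes
  -- the `1/4`.
  have hmono : E (fun ω a => N a * tilt ε (played a i) ω) ≤
      E (fun ω a => N a + T * (4 * (tilt ε (played a i) ω - 1 -
        Real.log (tilt ε (played a i) ω)) + (1 + tilt ε (played a i) ω) / 8)) := by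
    refine sum_le_sum fun a _ => expect_le_expect fun ω _ => ?_
    refine mul_le_mul_of_nonneg_left ?_ (tilt_pos h0 h1 _ ω).le
    refine mul_le_mul_of_nonneg_left ?_ (playProb_nonneg π _ a)
    have hLp := tilt_pos h0 h1 (played a i) ω
    have hb := sub_one_le_log_bound hLp
    have hb0 := Real.log_le_sub_one_of_pos hLp
    set L := tilt ε (played a i) ω
    have hX : 0 ≤ 4 * (L - 1 - Real.log L) + (1 + L) / 8 := by linarith
    have := mul_le_mul_of_nonneg_left hb (hN0 a)
    have := mul_le_mul_of_nonneg_right (hNT a) hX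
    linarith
  have hlin : E (fun ω a => N a + T * (4 * (tilt ε (played a i) ω - 1 -
        Real.log (tilt ε (played a i) ω)) + (1 + tilt ε (played a i) ω) / 8)) =
      E (fun _ a => N a) + T * (4 * (E (fun ω a => tilt ε (played a i) ω) - E (fun _ _ => 1) -
        E (fun ω a => Real.log (tilt ε (played a i) ω))) +
        (E (fun _ _ => 1) + E (fun ω a => tilt ε (played a i) ω)) / 8) := by
    simp only [hE, mul_sum, sum_div, ← sum_add_distrib, ← sum_sub_distrib, mul_expect,
      expect_div, ← expect_add_distrib, ← expect_sub_distrib]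
    exact sum_congr rfl fun a _ => expect_congr rfl fun ω _ => by ring
  rw [hlin, hone, hL, hlog, hN, hNL] at hmono
  refine hmono.trans ?_
  have hp := mul_le_mul_of_nonneg_right (neg_sq_le_log hε) (pulls_nonneg h0 h1 π S i)
  refine add_le_add_right (mul_le_mul_of_nonneg_left ?_ T.cast_nonneg) _
  linarith

end Tilted

/-! ### Averaging over the hidden set by symmetry -/

section Permutations

variable {K : ℕ}

/-- Swapping `j` with any `j' ∉ J` fixes `J.erase j`, so all these coordinates have the same
average, and together they share at most `M`. -/
theorem mul_sum_perm_le (J : Finset (Fin K)) (j : Fin K) {M : ℝ}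
    (h : Finset (Fin K) → Fin K → ℝ) (h0 : ∀ S i, 0 ≤ h S i) (hM : ∀ S, ∑ i, h S i ≤ M) :
    ((Jᶜ).card : ℝ) * ∑ σ : Equiv.Perm (Fin K), h ((J.erase j).map σ.toEmbedding) (σ j) ≤
      Fintype.card (Equiv.Perm (Fin K)) * M := by
  have hswap : ∀ j' ∈ Jᶜ,
      ∑ σ : Equiv.Perm (Fin K), h ((J.erase j).map σ.toEmbedding) (σ j) =
        ∑ σ : Equiv.Perm (Fin K), h ((J.erase j).map σ.toEmbedding) (σ j') := by
    intro j' hj'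
    rw [← Equiv.sum_comp (Equiv.mulRight (Equiv.swap j j'))]
    refine sum_congr rfl fun σ _ => ?_
    have h1 : (J.erase j).map (σ * Equiv.swap j j').toEmbedding =
        (J.erase j).map σ.toEmbedding := by
      rw [map_eq_image, map_eq_image]
      refine image_congr fun x hx => ?_
      have hx' := mem_erase.1 (mem_coe.1 hx)
      have : x ≠ j' := by
        rintro rfl
        exact (mem_compl.1 hj') hx'.2
      simp [Equiv.swap_apply_of_ne_of_ne hx'.1 this]
    simp only [Equiv.coe_mulRight, h1, Equiv.Perm.coe_mul, comp_apply, Equiv.swap_apply_left]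
  calc ((Jᶜ).card : ℝ) * ∑ σ : Equiv.Perm (Fin K), h ((J.erase j).map σ.toEmbedding) (σ j)
      = ∑ j' ∈ Jᶜ, ∑ σ : Equiv.Perm (Fin K), h ((J.erase j).map σ.toEmbedding) (σ j') := by
        rw [← sum_congr rfl hswap, sum_const, nsmul_eq_mul]
    _ = ∑ σ : Equiv.Perm (Fin K), ∑ j' ∈ Jᶜ, h ((J.erase j).map σ.toEmbedding) (σ j') :=
        sum_comm
    _ ≤ ∑ σ : Equiv.Perm (Fin K), M := sum_le_sum fun σ _ => by
        refine le_trans ?_ (hM ((J.erase j).map σ.toEmbedding))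
        rw [← Equiv.sum_comp σ]
        exact sum_le_sum_of_subset_of_nonneg (subset_univ _) fun _ _ _ => h0 _ _
    _ = _ := by rw [sum_const, card_univ, nsmul_eq_mul]

end Permutations

/-! ### Assembling the feedback term -/

section Mixture

variable {K T d : ℕ}

/-- The expected regret, averaged over a uniformly random set of `B` slightly better
coordinates. -/
theorem le_sum_perm_expectedRegret {B : ℕ} (hB : B ≤ K) {ε : ℝ} (h0 : 0 ≤ ε)
    (hε : ε ^ 2 ≤ 1 / 2) (π : Algorithm (bSets K B) T d) {J : Finset (Fin K)}
    (hJ : J.card = B) (hBK : B < K) :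
    Fintype.card (Equiv.Perm (Fin K)) *
        (ε * B * T * (3 / 4 - (1 + 4 * ε ^ 2 * T) * (B / (K - B)))) ≤
      ∑ σ : Equiv.Perm (Fin K), 𝔼 ω, tilt ε (univ ×ˢ J.map σ.toEmbedding) ω *
        expectedRegret π (signLoss ω) := by
  have h1 : ε < 1 := by nlinarith
  have hne := bSets_nonempty hB
  set P := (Fintype.card (Equiv.Perm (Fin K)) : ℝ) with hP
  set h : Fin K → Equiv.Perm (Fin K) → ℝ := fun j σ =>
    pulls ε π ((J.erase j).map σ.toEmbedding) (σ j)
  have hKB : (0 : ℝ) < K - B := by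
    have : (B : ℝ) < K := by exact_mod_cast hBK
    linarith
  have havg : ∀ j, ∑ σ, h j σ ≤ P * (B * T) / (K - B) := by
    intro j
    have := mul_sum_perm_le J j (pulls ε π) (pulls_nonneg h0 h1 π)
      (fun S => (sum_pulls hB ε π S).le)
    rw [card_compl, Fintype.card_fin, hJ, Nat.cast_sub hB] at this
    rw [le_div_iff₀ hKB, mul_comm]
    exact this
  have hσ : ∀ σ : Equiv.Perm (Fin K),
      ε * ∑ j ∈ J, (3 / 4 * T - (1 + 4 * ε ^ 2 * T) * h j σ) ≤
        𝔼 ω, tilt ε (univ ×ˢ J.map σ.toEmbedding) ω * expectedRegret π (signLoss ω) := by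
    intro σ
    refine le_trans (mul_le_mul_of_nonneg_left ?_ h0)
      (le_expect_tilt_mul_expectedRegret hB h0 h1 π (by rw [card_map, hJ]))
    rw [sum_map]
    refine sum_le_sum fun j hj => ?_
    -- Each good coordinate is compared with the environment in which it alone is made neutral.
    have hins : J.map σ.toEmbedding = insert (σ j) ((J.erase j).map σ.toEmbedding) := by
      conv_lhs => rw [← insert_erase hj, map_insert]
      rfl
    have hnot : σ j ∉ (J.erase j).map σ.toEmbedding := by simp
    have := pulls_insert_le hne h0 hε π hnot
    rw [← hins] at this
    change 3 / 4 * T - (1 + 4 * ε ^ 2 * T) * h j σ ≤ T - pulls ε π (J.map σ.toEmbedding) (σ j)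
    simp only [h]
    linarith
  refine le_trans ?_ (sum_le_sum fun σ _ => hσ σ)
  rw [← mul_sum, sum_comm]
  have hj : ∀ j ∈ J, P * T * (3 / 4 - (1 + 4 * ε ^ 2 * T) * (B / (K - B))) ≤
      ∑ σ, (3 / 4 * T - (1 + 4 * ε ^ 2 * T) * h j σ) := by
    intro j _
    rw [sum_sub_distrib, sum_const, card_univ, nsmul_eq_mul, ← hP, ← mul_sum]
    have := mul_le_mul_of_nonneg_left (havg j) (show 0 ≤ 1 + 4 * ε ^ 2 * T by positivity)
    have e : (1 + 4 * ε ^ 2 * T) * (P * (B * T) / (K - B)) =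
      P * T * ((1 + 4 * ε ^ 2 * T) * (B / (K - B))) := by ring
    linarith
  have := mul_le_mul_of_nonneg_left (sum_le_sum hj) h0
  refine le_trans (le_of_eq ?_) this
  rw [sum_const, hJ, nsmul_eq_mul]
  ring

/-- The lower bound from the limited feedback. -/
theorem exists_pmf_tilt_bound {B : ℕ} (d : ℕ) (hB : 0 < B) (hBK : 8 * B ≤ K) (hKT : K ≤ B * T) :
    ∃ μ : PMF (Fin T → Fin K → ℝ),
      (∀ l ∈ μ.support, ∀ t i, l t i ∈ Set.Icc (-1 : ℝ) 1) ∧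
      ∀ π : Algorithm (bSets K B) T d,
        1 / 15 * √((B : ℝ) * K * T) ≤ ∑' l, (μ l).toReal * expectedRegret π l := by
  have hT : 0 < T := Nat.pos_of_ne_zero fun h => by subst h; omega
  have hB' : (0 : ℝ) < B := by exact_mod_cast hB
  have hT' : (0 : ℝ) < T := by exact_mod_cast hT
  have hBK' : 8 * (B : ℝ) ≤ K := by exact_mod_cast hBK
  have hKT' : (K : ℝ) ≤ B * T := by exact_mod_cast hKT
  -- That is `ε = √(K/(BT))/5`, at most `1/5` because `K ≤ BT`.
  set ε : ℝ := √((B : ℝ) * K * T) / (5 * B * T) with hεdef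
  have h0 : 0 ≤ ε := by positivity
  have hsq : ε ^ 2 = K / (25 * B * T) := by
    rw [hεdef, div_pow, Real.sq_sqrt (by positivity)]
    field_simp
    norm_num
  have hε : ε ^ 2 ≤ 1 / 2 := by
    rw [hsq, div_le_iff₀ (by positivity)]
    nlinarith
  have h1 : ε < 1 := by nlinarith
  obtain ⟨J, -, hJ⟩ := exists_subset_card_eq (s := (univ : Finset (Fin K))) (n := B)
    (by rw [card_univ, Fintype.card_fin]; omega)
  obtain ⟨μ, hμ, hf⟩ := exists_pmf_of_weights
    (fun p : Equiv.Perm (Fin K) × (Fin T × Fin K → Bool) =>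
      (Fintype.card (Equiv.Perm (Fin K)) : ℝ)⁻¹ *
        (tilt ε (univ ×ˢ J.map p.1.toEmbedding) p.2 / Fintype.card (Fin T × Fin K → Bool)))
    (fun p => mul_nonneg (by positivity) (div_nonneg (tilt_pos h0 h1 _ _).le (by positivity)))
    (by
      rw [Fintype.sum_prod_type]
      simp only [← mul_sum, ← sum_div, ← Fintype.expect_eq_sum_div_card, expect_tilt]
      simp) (fun p => signLoss p.2)
  refine ⟨μ, fun l hl t i => ?_, fun π => ?_⟩
  · obtain ⟨p, rfl⟩ := hμ l hl
    exact rad_mem_Icc _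
  rw [hf, Fintype.sum_prod_type]
  simp only [mul_assoc, ← mul_sum, div_mul_eq_mul_div, ← sum_div,
    ← Fintype.expect_eq_sum_div_card]
  have hc : (0 : ℝ) < Fintype.card (Equiv.Perm (Fin K)) := by
    exact_mod_cast Fintype.card_pos
  rw [inv_mul_eq_div, le_div_iff₀ hc, mul_comm]
  refine le_trans (mul_le_mul_of_nonneg_left ?_ hc.le)
    (le_sum_perm_expectedRegret (by omega) h0 hε π hJ (by omega))
  have hεBT : ε * B * T = √((B : ℝ) * K * T) / 5 := by
    rw [hεdef]
    field_simp
  have hKB : (0 : ℝ) < K - B := by linarith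
  -- Uses `8B ≤ K`. The remaining fraction `3/4 - 5/12 = 1/3` times `εBT = √(BKT)/5` gives `1/15`.
  have hq : (1 + 4 * ε ^ 2 * T) * (B / (K - B)) ≤ 5 / 12 := by
    have : (1 + 4 * ε ^ 2 * T) * (B / (K - B)) = (B + 4 / 25 * K) / (K - B) := by
      rw [hsq]
      field_simp
    rw [this, div_le_iff₀ hKB]
    linarith
  rw [hεBT, ← mul_assoc]
  have := mul_le_mul_of_nonneg_left hq (Real.sqrt_nonneg ((B : ℝ) * K * T))
  linarith

end Mixture

end DelayedSemiBandit

/-! ### Combining the two constructions -/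

theorem mainTheorem6 :
    ∃ c : ℝ, 0 < c ∧ ∀ K B T d : ℕ, 2 * B ≤ K → K ≤ B * T → d ≤ T →
      ∃ μ : PMF (Fin T → Fin K → ℝ),
        (∀ l ∈ μ.support, ∀ t i, l t i ∈ Set.Icc (-1 : ℝ) 1) ∧
        ∀ π : DelayedSemiBandit.Algorithm (DelayedSemiBandit.bSets K B) T d,
          c * max (Real.sqrt ((B : ℝ) * K * T)) ((B : ℝ) * Real.sqrt ((d : ℝ) * T)) ≤
            ∑' l, (μ l).toReal * DelayedSemiBandit.expectedRegret π l := by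
  refine ⟨1 / 20, by norm_num, fun K B T d h2 hKT hd => ?_⟩
  have hdm : (B : ℝ) * √((d : ℝ) * T) ≤ B * √((max 1 d : ℕ) * T) := by
    gcongr
    exact le_max_right 1 d
  have hblock0 : 0 ≤ (B : ℝ) * √((max 1 d : ℕ) * T) := by positivity
  have hroot0 : 0 ≤ √((B : ℝ) * K * T) := Real.sqrt_nonneg _
  -- If `K ≤ 8B` then `√(BKT) ≤ √8 · B√T`, so the block bound covers both terms up to the factor
  -- `3`, and `1/18 ≥ 1/20`. This case also absorbs `B = 0`.
  by_cases hcase : K ≤ 8 * B ∨ √((B : ℝ) * K * T) ≤ B * √((d : ℝ) * T)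
  · obtain ⟨μ, hμ, hle⟩ := DelayedSemiBandit.exists_pmf_block_bound h2 hd
    refine ⟨μ, hμ, fun π => le_trans ?_ (hle π)⟩
    have hroot : √((B : ℝ) * K * T) ≤ 3 * (B * √((max 1 d : ℕ) * T)) := by
      rcases hcase with hK | hr
      · have hm : (1 : ℝ) ≤ (max 1 d : ℕ) := by exact_mod_cast le_max_left 1 d
        have hK' : (K : ℝ) ≤ 8 * B := by exact_mod_cast hK
        rw [Real.sqrt_le_left (by positivity), mul_pow, mul_pow, Real.sq_sqrt (by positivity)]
        calc (B : ℝ) * K * T ≤ B * (8 * B) * T := by gcongr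
          _ = 8 * (B ^ 2 * (1 * T)) := by ring
          _ ≤ 8 * (B ^ 2 * ((max 1 d : ℕ) * T)) := by gcongr
          _ ≤ 3 ^ 2 * (B ^ 2 * ((max 1 d : ℕ) * T)) := by
            gcongr
            norm_num
      · linarith
    have := max_le hroot (hdm.trans (by linarith))
    linarith
  · obtain ⟨hK, hr⟩ := not_or.1 hcase
    have hB : 0 < B := Nat.pos_of_ne_zero fun h => by subst h; omega
    obtain ⟨μ, hμ, hle⟩ := DelayedSemiBandit.exists_pmf_tilt_bound d hB (by omega) hKT
    refine ⟨μ, hμ, fun π => le_trans ?_ (hle π)⟩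
    rw [max_eq_left (not_le.1 hr).le]
    linarith
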